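/- Let $|p\rangle=\sqrt p\,|0\rangle+\sqrt{1-p}\,|1\rangle$ for $p\in[0,1]$. A pair of functions $k_0,k_1:[0,1]\to\mathbb C$ with $|k_0|^2+|k_1|^2=1$ is called simulable if there is a procedure with finitely many steps, not depending on $p$, that starts with no qubits and in each step, possibly depending on earlier measurement outcomes, either brings in a fresh copy of $|p\rangle$, or brings in a constant qubit $(a|0\rangle+|1\rangle)/\sqrt{|a|^2+1}$ with $a\in\mathbb C$, or applies a unitary transformation to the current qubits, or measures one of the current qubits in the computational basis, or ends with success or failure, such that for every $p\in[0,1]$ the procedure succeeds with nonzero probability and, whenever it succeeds, its output is the qubit $k_0(p)|0\rangle+k_1(p)|1\rangle$ up to a global phase. Let $$QQ=\{\,f:[0,1]\to[0,1] \;:\; f(p)=|k_0(p)|^2 \text{ for all } p, \text{ for some simulable pair } (k_0,k_1)\,\}.$$ Let $QC$ be the set of all $f:[0,1]\to[0,1]$ for which there is an adaptive protocol, not depending on $p$, that uses fresh coins $|p\rangle$ one at a time, applies to each a gate chosen (according to the previous outcomes) from a finite set of single-qubit unitaries, measures it in the computational basis, and for every $p\in[0,1]$ stops with probability one and outputs $1$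 with probability exactly $f(p)$ and $0$ otherwise. A function $f:[0,1]\to[0,1]$ is simple and poly-bounded (SPB) if 1. $f$ is continuous; 2. $Z=\{z: f(z)=0\}$ and $W=\{w: f(w)=1\}$ are finite; 3. for every $z\in Z$ there are constants $c,\delta>0$ and an integer $k\ge 0$ with $c(p-z)^{2k}\le f(p)$ for all $p\in[z-\delta,z+\delta]\cap[0,1]$; 4. for every $w\in W$ there are constants $c,\delta>0$ and an integer $k\ge 0$ with $f(p)\le 1-c(p-w)^{2k}$ for all $p\in[w-\delta,w+\delta]\cap[0,1]$. Then every $f\in QQ$ other than the constant functions $0$ and $1$ is SPB, and $QQ\subseteq QC$. -/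

import Mathlib

noncomputable section

namespace BernoulliFactory

/-- Amplitude vectors of an `n`-qubit register, indexed by the computational basis
(not necessarily normalised). -/
abbrev QState (n : ℕ) : Type := (Fin n → Fin 2) → ℂ

/-- The single-qubit gates. -/
abbrev Gate : Type := Matrix.unitaryGroup (Fin 2) ℂ

/-- Amplitudes of the quantum coin `|p⟩ = √p |0⟩ + √(1-p) |1⟩`. -/
def coinKet (p : unitInterval) : Fin 2 → ℂ :=
  ![((√(p : ℝ) : ℝ) : ℂ), ((√(1 - (p : ℝ)) : ℝ) : ℂ)]

/-- Amplitudes of the constant qubit `|a_c⟩ = (a |0⟩ + |1⟩) / √(|a|² + 1)`. -/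
def constKet (a : ℂ) : Fin 2 → ℂ :=
  ![a / ((√(‖a‖ ^ 2 + 1) : ℝ) : ℂ), 1 / ((√(‖a‖ ^ 2 + 1) : ℝ) : ℂ)]

/-- The joint state of a register in state `ψ` and one further qubit in state `φ`. -/
def adjoin {n : ℕ} (ψ : QState n) (φ : Fin 2 → ℂ) : QState (n + 1) :=
  fun x => ψ (Fin.init x) * φ (x (Fin.last n))

/-- The unnormalised state of the other qubits after qubit `i` has been measured in the
computational basis with outcome `b`. Its squared norm is the probability of that outcome
times the squared norm of `ψ`. -/
def collapse {n : ℕ} (i : Fin (n + 1)) (b : Fin 2) (ψ : QState (n + 1)) : QState n :=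
  fun x => ψ (Fin.insertNth (α := fun _ => Fin 2) i b x)

/-! ### Quantum-to-quantum procedures -/

/-- `Procedure n` is a procedure with finitely many steps, adaptive in the measurement
outcomes, that starts from a register of `n` qubits. None of its data depends on `p`.
Other states prepared by such a procedure may be used as auxiliary qubits by preparing them
inside the register. -/
inductive Procedure : ℕ → Type
  /-- Declare success; the one remaining qubit is the output. -/
  | done : Procedure 1
  /-- Declare failure. -/
  | fail {n : ℕ} : Procedure n
  /-- Bring in a fresh quantum coin `|p⟩`. -/
  | coin {n : ℕ} (next : Procedure (n + 1)) : Procedure n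
  /-- Bring in a fresh constant qubit `|a_c⟩`. -/
  | const {n : ℕ} (a : ℂ) (next : Procedure (n + 1)) : Procedure n
  /-- Apply a unitary transformation to the register. -/
  | unitary {n : ℕ} (U : Matrix.unitaryGroup (Fin n → Fin 2) ℂ) (next : Procedure n) :
      Procedure n
  /-- Measure qubit `i`, drop it, and continue according to the outcome. -/
  | measure {n : ℕ} (i : Fin (n + 1)) (next : Fin 2 → Procedure n) : Procedure (n + 1)

/-- The unnormalised output qubits of all successful runs, when the coins are `|p⟩` and the
register starts in state `ψ`. If `ψ` is a unit vector, the squared norm of an entry is the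
probability of the corresponding run. -/
def Procedure.outputs (p : unitInterval) : {n : ℕ} → Procedure n → QState n → List (QState 1)
  | _, .done, ψ => [ψ]
  | _, .fail, _ => []
  | _, .coin next, ψ => next.outputs p (adjoin ψ (coinKet p))
  | _, .const a next, ψ => next.outputs p (adjoin ψ (constKet a))
  | _, .unitary U next, ψ => next.outputs p ((U : Matrix _ _ ℂ).mulVec ψ)
  | _, .measure i next, ψ =>
      (next 0).outputs p (collapse i 0 ψ) ++ (next 1).outputs p (collapse i 1 ψ)

/-- The state of the empty register. -/
def emptyRegister : QState 0 := fun _ => 1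

/-- The success probability of a procedure that starts from the empty register. -/
def Procedure.successProb (P : Procedure 0) (p : unitInterval) : ℝ :=
  ((P.outputs p emptyRegister).map fun φ => ∑ x, ‖φ x‖ ^ 2).sum

/-- The tuple `(k₀, k₁)` is simulable: `|k₀|² + |k₁|² = 1`, and one procedure, not depending
on `p`, has for every `p ∈ [0,1]` a nonzero success probability and in every successful run of
nonzero probability outputs `k₀(p) |0⟩ + k₁(p) |1⟩` up to a global phase. (A nonzero
unnormalised output represents this state exactly if it is a complex multiple of it; a run of
probability zero has output `0`, for which `c = 0` serves.) -/
def Simulable (k₀ k₁ : unitInterval → ℂ) : Prop :=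
  (∀ p, ‖k₀ p‖ ^ 2 + ‖k₁ p‖ ^ 2 = 1) ∧
  ∃ P : Procedure 0, ∀ p, 0 < P.successProb p ∧
    ∀ φ ∈ P.outputs p emptyRegister, ∃ c : ℂ, ∀ x : Fin 1 → Fin 2,
      φ x = c * ![k₀ p, k₁ p] (x 0)

/-- The functions `|k₀|²` of simulable tuples `(k₀, k₁)`. -/
def QQ : Set (unitInterval → unitInterval) :=
  {f | ∃ k₀ k₁ : unitInterval → ℂ, Simulable k₀ k₁ ∧ ∀ p, (f p : ℝ) = ‖k₀ p‖ ^ 2}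

/-! ### Quantum-to-classical protocols -/

/-- An adaptive protocol that tosses quantum coins one at a time. Depending on the outcomes
obtained so far (most recent first) it either applies a single-qubit gate to a fresh coin and
measures it in the computational basis, or it stops and announces a bit. It uses only finitely
many different gates. -/
structure CoinProtocol where
  step : List (Fin 2) → Gate ⊕ Bool
  finite_gates : {U : Gate | ∃ w, step w = Sum.inl U}.Finite

/-- The probability that a protocol that uses the coins `|p⟩` sees the outcomes `w`. -/
def CoinProtocol.reachProb (S : CoinProtocol) (p : unitInterval) : List (Fin 2) → ℝ
  | [] => 1
  | b :: w =>
      match S.step w with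
      | Sum.inl U => S.reachProb p w * ‖(U : Matrix (Fin 2) (Fin 2) ℂ).mulVec (coinKet p) b‖ ^ 2
      | Sum.inr _ => 0

/-- The probability that the protocol sees the outcomes `w` and then stops, announcing `b`. -/
def CoinProtocol.stopProb (S : CoinProtocol) (p : unitInterval) (b : Bool)
    (w : List (Fin 2)) : ℝ :=
  match S.step w with
  | Sum.inl _ => 0
  | Sum.inr b' => if b' = b then S.reachProb p w else 0

/-- The functions `f` for which some protocol, not depending on `p`, stops with probability one
and announces `true` with probability exactly `f(p)`, for every `p ∈ [0,1]`. -/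
def QC : Set (unitInterval → unitInterval) :=
  {f | ∃ S : CoinProtocol, ∀ p,
    HasSum (S.stopProb p true) (f p : ℝ) ∧ HasSum (S.stopProb p false) (1 - (f p : ℝ))}

/-! ### Simple and poly-bounded functions -/

/-- `f` is simple and poly-bounded. -/
structure SPB (f : unitInterval → unitInterval) : Prop where
  continuous : Continuous f
  finite_zeros : {z | f z = 0}.Finite
  finite_ones : {w | f w = 1}.Finite
  bound_zeros : ∀ z, f z = 0 → ∃ c δ : ℝ, 0 < c ∧ 0 < δ ∧ ∃ k : ℕ, ∀ p : unitInterval,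
    (p : ℝ) ∈ Set.Icc ((z : ℝ) - δ) (z + δ) →
      c * ((p : ℝ) - z) ^ (2 * k) ≤ (f p : ℝ)
  bound_ones : ∀ w, f w = 1 → ∃ c δ : ℝ, 0 < c ∧ 0 < δ ∧ ∃ k : ℕ, ∀ p : unitInterval,
    (p : ℝ) ∈ Set.Icc ((w : ℝ) - δ) (w + δ) →
      (f p : ℝ) ≤ 1 - c * ((p : ℝ) - w) ^ (2 * k)

end BernoulliFactory

end

noncomputable section

namespace BernoulliFactory

open Filter Topology

/-! ### Finite measurement trees -/

/-! Measurement outcomes are kept unnormalised, so every amplitude of a register is a homogeneous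
polynomial in `√p` and `√(1 - p)` whose degree is the number of coins brought in
(`Procedure.exists_outputs_eq`). Over `ℂ` such a binary form splits into linear forms
(`factored_homogEval`). Every successful output is a multiple of `(k₀, k₁)`, so `f = A / (A + B)`
with `A`, `B` sums of squared moduli of products of linear forms and `A + B > 0` everywhere
(`exists_weights_of_mem_QQ`).

For `QQ ⊆ QC`: up to scale, the squared modulus of a linear form is the probability of an outcome of
one toss. A product is realised by successive tosses, and a sum by a random choice between trees,
once the scales are equalised with coins of constant bias (`exists_tree_bias`). Repeating the
resulting finite tree until it gives a result divides by `A + B` (`hasSum_loop`).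

For SPB: a nonzero linear form has at most one zero in `[0,1]`, and near it the squared modulus is
at least a multiple of `(p - z) ^ 2`. Products and sums inherit such bounds, and compactness bounds
`A + B` from above. -/

/-- The probability of outcome `b` when a coin `|p⟩` is measured after applying `U`. -/
def tossProb (U : Gate) (p : unitInterval) (b : Fin 2) : ℝ :=
  ‖(U : Matrix (Fin 2) (Fin 2) ℂ).mulVec (coinKet p) b‖ ^ 2

theorem tossProb_nonneg (U : Gate) (p : unitInterval) (b : Fin 2) : 0 ≤ tossProb U p b := by
  unfold tossProb; positivity

/-- The amplitude `√p`. -/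
def ampZero (p : unitInterval) : ℝ := √(p : ℝ)

/-- The amplitude `√(1 - p)`. -/
def ampOne (p : unitInterval) : ℝ := √(1 - (p : ℝ))

theorem ampZero_sq (p : unitInterval) : ampZero p ^ 2 = p := Real.sq_sqrt p.2.1

theorem ampOne_sq (p : unitInterval) : ampOne p ^ 2 = 1 - p :=
  Real.sq_sqrt (by linarith [p.2.2])

theorem ampZero_sq_add_ampOne_sq (p : unitInterval) : ampZero p ^ 2 + ampOne p ^ 2 = 1 := by
  rw [ampZero_sq, ampOne_sq]; ring

theorem continuous_ampZero : Continuous ampZero := by unfold ampZero; fun_prop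

theorem continuous_ampOne : Continuous ampOne := by unfold ampOne; fun_prop

theorem normSq_mulVec (U : Gate) (v : Fin 2 → ℂ) :
    ‖(U : Matrix (Fin 2) (Fin 2) ℂ).mulVec v 0‖ ^ 2 +
      ‖(U : Matrix (Fin 2) (Fin 2) ℂ).mulVec v 1‖ ^ 2 = ‖v 0‖ ^ 2 + ‖v 1‖ ^ 2 := by
  have key : ∀ w : Fin 2 → ℂ, ((‖w 0‖ ^ 2 + ‖w 1‖ ^ 2 : ℝ) : ℂ) = star w ⬝ᵥ w := by
    intro w
    simp only [dotProduct, Fin.sum_univ_two, Pi.star_apply, RCLike.star_def, Complex.conj_mul']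
    push_cast
    rfl
  have h := key ((U : Matrix (Fin 2) (Fin 2) ℂ).mulVec v)
  rw [Matrix.star_mulVec, ← Matrix.dotProduct_mulVec, Matrix.mulVec_mulVec,
    ← Matrix.star_eq_conjTranspose, Unitary.coe_star_mul_self, Matrix.one_mulVec, ← key] at h
  exact_mod_cast h

theorem tossProb_add (U : Gate) (p : unitInterval) : tossProb U p 0 + tossProb U p 1 = 1 := by
  unfold tossProb
  rw [normSq_mulVec]
  have h := ampZero_sq_add_ampOne_sq p
  simp only [ampZero, ampOne] at h
  simpa [coinKet] using h

/-- The gate with first row `(a, b)`. -/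
def rowGate (a b : ℂ) (h : ‖a‖ ^ 2 + ‖b‖ ^ 2 = 1) : Gate :=
  ⟨!![a, b; -star b, star a], by
    have h' : a * star a + b * star b = 1 := by
      simp only [RCLike.star_def, Complex.mul_conj']
      exact_mod_cast h
    rw [Matrix.mem_unitaryGroup_iff]
    ext i j
    fin_cases i <;> fin_cases j <;>
      simp [Matrix.mul_apply, Fin.sum_univ_two] <;> simp at h' <;>
      first | linear_combination h' | ring1⟩

theorem tossProb_rowGate_zero (a b : ℂ) (h : ‖a‖ ^ 2 + ‖b‖ ^ 2 = 1) (p : unitInterval) :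
    tossProb (rowGate a b h) p 0 = ‖a * ampZero p + b * ampOne p‖ ^ 2 := by
  simp [tossProb, rowGate, coinKet, Matrix.mulVec, dotProduct, ampZero, ampOne]

/-- An adaptive protocol with finitely many coin tosses and result in `α`. -/
inductive Tree (α : Type) : Type
  | leaf (a : α) : Tree α
  | node (U : Gate) (c : Fin 2 → Tree α) : Tree α

namespace Tree

variable {α β : Type}

/-- The expected value of `g` at the result of the tree. -/
def eval (p : unitInterval) (g : α → ℝ) : Tree α → ℝ
  | leaf a => g a
  | node U c => tossProb U p 0 * (c 0).eval p g + tossProb U p 1 * (c 1).eval p g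

/-- Continue with a tree depending on the result of the first one. -/
def bind (k : α → Tree β) : Tree α → Tree β
  | leaf a => k a
  | node U c => node U fun i => (c i).bind k

theorem eval_bind (p : unitInterval) (k : α → Tree β) (g : β → ℝ) (t : Tree α) :
    (t.bind k).eval p g = t.eval p fun a => (k a).eval p g := by
  induction t with
  | leaf a => rfl
  | node U c ih => simp [bind, eval, ih]

/-- The gates of a tree. -/
def gates : Tree α → Set Gate
  | leaf _ => ∅
  | node U c => {U} ∪ ((c 0).gates ∪ (c 1).gates)

theorem finite_gates (t : Tree α) : t.gates.Finite := by
  induction t with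
  | leaf a => exact Set.finite_empty
  | node U c ih => exact (Set.finite_singleton U).union ((ih 0).union (ih 1))

theorem gates_child_subset (U : Gate) (c : Fin 2 → Tree α) (i : Fin 2) :
    (c i).gates ⊆ (node U c).gates := by
  intro V hV
  fin_cases i
  · exact Or.inr (Or.inl hV)
  · exact Or.inr (Or.inr hV)

theorem eval_add (p : unitInterval) (g h : α → ℝ) (t : Tree α) :
    t.eval p (fun a => g a + h a) = t.eval p g + t.eval p h := by
  induction t with
  | leaf a => rfl
  | node U c ih => simp only [eval, ih]; ring

theorem eval_mul_right (p : unitInterval) (g : α → ℝ) (r : ℝ) (t : Tree α) :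
    t.eval p (fun a => g a * r) = t.eval p g * r := by
  induction t with
  | leaf a => rfl
  | node U c ih => simp only [eval, ih]; ring

theorem eval_const (p : unitInterval) (r : ℝ) (t : Tree α) : t.eval p (fun _ => r) = r := by
  induction t with
  | leaf a => rfl
  | node U c ih => simp only [eval, ih, ← add_mul, tossProb_add, one_mul]

end Tree

/-! ### Repeating a tree until it gives a result -/

/-- The indicator of the result `some b`. -/
def hit (b : Bool) (o : Option Bool) : ℝ := if o = some b then 1 else 0

/-- Replace a tree that has failed by `root`. -/
def restart (root : Tree (Option Bool)) : Tree (Option Bool) → Tree (Option Bool)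
  | .leaf none => root
  | .leaf (some b) => .leaf (some b)
  | .node U c => .node U c

/-- The tree that remains after outcome `i` of the first toss. -/
def advance (root : Tree (Option Bool)) (i : Fin 2) : Tree (Option Bool) → Tree (Option Bool)
  | .leaf o => .leaf o
  | .node _ c => restart root (c i)

/-- The action prescribed by a tree. -/
def action : Tree (Option Bool) → Gate ⊕ Bool
  | .leaf none => Sum.inr false
  | .leaf (some b) => Sum.inr b
  | .node U _ => Sum.inl U

theorem gates_restart_subset (root t : Tree (Option Bool)) :
    (restart root t).gates ⊆ root.gates ∪ t.gates := by
  match t with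
  | .leaf none => exact Set.subset_union_left
  | .leaf (some b) => exact Set.subset_union_right
  | .node U c => exact Set.subset_union_right

theorem gates_foldr_advance_subset (root t : Tree (Option Bool)) (w : List (Fin 2)) :
    (w.foldr (advance root) t).gates ⊆ root.gates ∪ t.gates := by
  induction w with
  | nil => exact Set.subset_union_right
  | cons i w ih =>
    rw [List.foldr_cons]
    cases h : w.foldr (advance root) t with
    | leaf o => exact Set.empty_subset _
    | node U c =>
      rw [h] at ih
      refine (gates_restart_subset root (c i)).trans (Set.union_subset Set.subset_union_left ?_)
      exact (Tree.gates_child_subset U c i).trans ih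

/-- The protocol that starts with the tree `t` and then repeats `root` until it gives a result. -/
def loopFrom (root t : Tree (Option Bool)) : CoinProtocol where
  step w := action (w.foldr (advance root) t)
  finite_gates := by
    refine (root.finite_gates.union t.finite_gates).subset ?_
    rintro U ⟨w, hw⟩
    apply gates_foldr_advance_subset root t w
    match h : w.foldr (advance root) t with
    | .leaf none => simp [h, action] at hw
    | .leaf (some b) => simp [h, action] at hw
    | .node V c =>
      simp only [h, action, Sum.inl.injEq] at hw
      exact Or.inl hw.symm

variable {root : Tree (Option Bool)} {p : unitInterval} {b : Bool}

/-- Outcomes are listed most recent first, so the appended `i` is the first toss; after it the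
protocol is the loop started from the child `i`. -/
theorem loopFrom_step_concat (U : Gate) (c : Fin 2 → Tree (Option Bool)) (w : List (Fin 2))
    (i : Fin 2) :
    (loopFrom root (.node U c)).step (w ++ [i]) = (loopFrom root (restart root (c i))).step w := by
  simp [loopFrom, List.foldr_append, advance]

theorem loopFrom_reachProb_concat (U : Gate) (c : Fin 2 → Tree (Option Bool)) (w : List (Fin 2))
    (i : Fin 2) :
    (loopFrom root (.node U c)).reachProb p (w ++ [i]) =
      tossProb U p i * (loopFrom root (restart root (c i))).reachProb p w := by
  induction w with
  | nil =>
    have : (loopFrom root (.node U c)).step [] = Sum.inl U := rfl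
    simp [CoinProtocol.reachProb, this, tossProb]
  | cons j w ih =>
    simp only [List.cons_append, CoinProtocol.reachProb, loopFrom_step_concat, ih]
    cases (loopFrom root (restart root (c i))).step w with
    | inl V => simp only; ring
    | inr d => simp

theorem loopFrom_stopProb_concat (U : Gate) (c : Fin 2 → Tree (Option Bool)) (w : List (Fin 2))
    (i : Fin 2) :
    (loopFrom root (.node U c)).stopProb p b (w ++ [i]) =
      tossProb U p i * (loopFrom root (restart root (c i))).stopProb p b w := by
  simp only [CoinProtocol.stopProb, loopFrom_step_concat, loopFrom_reachProb_concat]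
  cases (loopFrom root (restart root (c i))).step w with
  | inl V => simp
  | inr d => simp

theorem reachProb_nonneg (S : CoinProtocol) (p : unitInterval) (w : List (Fin 2)) :
    0 ≤ S.reachProb p w := by
  induction w with
  | nil => simp [CoinProtocol.reachProb]
  | cons i w ih =>
    simp only [CoinProtocol.reachProb]
    cases S.step w with
    | inl U => simp only; positivity
    | inr d => simp

theorem stopProb_nonneg (S : CoinProtocol) (p : unitInterval) (b : Bool) (w : List (Fin 2)) :
    0 ≤ S.stopProb p b w := by
  simp only [CoinProtocol.stopProb]
  cases S.step w with
  | inl U => simp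
  | inr d => simp only; split_ifs <;> simp [reachProb_nonneg]

/-! ### Summation over outcome sequences -/

/-- The outcome sequences of length at most `n`. -/
def words : ℕ → Finset (List (Fin 2))
  | 0 => {[]}
  | n + 1 => insert [] ((words n).image (· ++ [0]) ∪ (words n).image (· ++ [1]))

theorem sum_words_succ (n : ℕ) (u : List (Fin 2) → ℝ) :
    ∑ w ∈ words (n + 1), u w =
      u [] + (∑ w ∈ words n, u (w ++ [0]) + ∑ w ∈ words n, u (w ++ [1])) := by
  have inj : ∀ i : Fin 2, Function.Injective fun w : List (Fin 2) => w ++ [i] :=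
    fun i => List.append_left_injective [i]
  rw [words, Finset.sum_insert (by simp), Finset.sum_union, Finset.sum_image (inj 0).injOn,
    Finset.sum_image (inj 1).injOn]
  rw [Finset.disjoint_left]
  rintro _ h0 h1
  obtain ⟨w, -, rfl⟩ := Finset.mem_image.1 h0
  obtain ⟨w', -, h⟩ := Finset.mem_image.1 h1
  simp at h

theorem mem_words {n : ℕ} {w : List (Fin 2)} : w ∈ words n ↔ w.length ≤ n := by
  induction n generalizing w with
  | zero => simp [words]
  | succ n ih =>
    rcases List.eq_nil_or_concat w with rfl | ⟨v, i, rfl⟩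
    · simp [words]
    · fin_cases i <;> simp [words, ih]

theorem tendsto_words : Tendsto words atTop atTop := by
  refine tendsto_atTop_finset_of_monotone (fun m n h w hw => ?_) fun w => ⟨w.length, ?_⟩
  · exact mem_words.2 ((mem_words.1 hw).trans h)
  · exact mem_words.2 le_rfl

theorem sum_words_loopFrom_node (U : Gate) (c : Fin 2 → Tree (Option Bool)) (n : ℕ) :
    ∑ w ∈ words (n + 1), (loopFrom root (.node U c)).stopProb p b w =
      tossProb U p 0 * ∑ w ∈ words n, (loopFrom root (restart root (c 0))).stopProb p b w +
      tossProb U p 1 * ∑ w ∈ words n, (loopFrom root (restart root (c 1))).stopProb p b w := by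
  rw [sum_words_succ]
  have : (loopFrom root (.node U c)).stopProb p b [] = 0 := rfl
  simp only [this, loopFrom_stopProb_concat, Finset.mul_sum, zero_add]

theorem loopFrom_leaf_step (o : Option Bool) (w : List (Fin 2)) :
    (loopFrom root (.leaf o)).step w = action (.leaf o) := by
  have : w.foldr (advance root) (.leaf o) = .leaf o := by
    induction w with
    | nil => rfl
    | cons i w ih => rw [List.foldr_cons, ih]; rfl
  simp [loopFrom, this]

theorem loopFrom_leaf_stopProb_of_ne_nil (o : Option Bool) {w : List (Fin 2)} (hw : w ≠ []) :
    (loopFrom root (.leaf o)).stopProb p b w = 0 := by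
  obtain ⟨i, w, rfl⟩ := List.exists_cons_of_ne_nil hw
  cases o <;>
    simp [CoinProtocol.stopProb, CoinProtocol.reachProb, loopFrom_leaf_step, action]

theorem loopFrom_leaf_stopProb_nil (d : Bool) :
    (loopFrom root (.leaf (some d))).stopProb p b [] = hit b (some d) := by
  simp [CoinProtocol.stopProb, CoinProtocol.reachProb, loopFrom_leaf_step, action, hit]

theorem stopProb_nil_le_one (S : CoinProtocol) : S.stopProb p b [] ≤ 1 := by
  simp only [CoinProtocol.stopProb]
  cases S.step [] with
  | inl U => simp
  | inr d => simp only [CoinProtocol.reachProb]; split_ifs <;> simp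

/-- Stopping after different sequences are disjoint events. The bound yields summability, which the
`tsum` equations below need. -/
theorem sum_words_loopFrom_le_one (n : ℕ) (t : Tree (Option Bool)) :
    ∑ w ∈ words n, (loopFrom root t).stopProb p b w ≤ 1 := by
  induction n generalizing t with
  | zero => simpa [words] using stopProb_nil_le_one _
  | succ n ih =>
    cases t with
    | leaf o =>
      rw [Finset.sum_eq_single_of_mem [] (mem_words.2 (by simp))
        fun w _ hw => loopFrom_leaf_stopProb_of_ne_nil o hw]
      exact stopProb_nil_le_one _
    | node U c =>
      rw [sum_words_loopFrom_node]
      have h0 := mul_le_mul_of_nonneg_left (ih (restart root (c 0))) (tossProb_nonneg U p 0)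
      have h1 := mul_le_mul_of_nonneg_left (ih (restart root (c 1))) (tossProb_nonneg U p 1)
      linarith [tossProb_add U p]

theorem summable_loopFrom (t : Tree (Option Bool)) :
    Summable ((loopFrom root t).stopProb p b) := by
  refine summable_of_sum_le (c := 1) (fun w => stopProb_nonneg _ _ _ _) fun s => ?_
  refine le_trans (Finset.sum_le_sum_of_subset_of_nonneg (t := words (s.sup List.length)) ?_
    fun w _ _ => stopProb_nonneg _ _ _ _) (sum_words_loopFrom_le_one _ t)
  exact fun w hw => mem_words.2 (Finset.le_sup (f := List.length) hw)

theorem tendsto_sum_words_loopFrom (t : Tree (Option Bool)) :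
    Tendsto (fun n => ∑ w ∈ words n, (loopFrom root t).stopProb p b w) atTop
      (𝓝 (∑' w, (loopFrom root t).stopProb p b w)) :=
  (summable_loopFrom t).hasSum.comp tendsto_words

theorem tsum_loopFrom_node (U : Gate) (c : Fin 2 → Tree (Option Bool)) :
    ∑' w, (loopFrom root (.node U c)).stopProb p b w =
      tossProb U p 0 * ∑' w, (loopFrom root (restart root (c 0))).stopProb p b w +
      tossProb U p 1 * ∑' w, (loopFrom root (restart root (c 1))).stopProb p b w := by
  -- Splitting off the first toss shortens the words by one, hence the shift of the index.
  refine tendsto_nhds_unique ((tendsto_sum_words_loopFrom _).comp (tendsto_add_atTop_nat 1)) ?_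
  simp only [Function.comp_def, sum_words_loopFrom_node]
  exact ((tendsto_sum_words_loopFrom _).const_mul _).add
    ((tendsto_sum_words_loopFrom _).const_mul _)


/-- The renewal equation: one pass through the tree either announces a bit or starts afresh. -/
theorem tsum_loopFrom_restart (t : Tree (Option Bool)) :
    ∑' w, (loopFrom root (restart root t)).stopProb p b w =
      t.eval p fun o => hit b o + (1 - (hit true o + hit false o)) *
        ∑' w, (loopFrom root root).stopProb p b w := by
  induction t with
  | leaf o =>
    match o with
    | none => simp [restart, Tree.eval, hit]
    | some d =>
      rw [restart, tsum_eq_single [] fun w hw => loopFrom_leaf_stopProb_of_ne_nil _ hw,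
        loopFrom_leaf_stopProb_nil]
      cases d <;> simp [Tree.eval, hit]
  | node U c ih =>
    rw [restart, tsum_loopFrom_node, ih, ih]
    rfl

/-- The renewal equation for `t` itself is linear in the announcing probability and determines it,
because the probability of a result in one pass is nonzero. Termination with probability one follows
by adding the values for both bits. -/
theorem hasSum_loop (t : Tree (Option Bool)) (p : unitInterval) (b : Bool)
    (h : t.eval p (hit true) + t.eval p (hit false) ≠ 0) :
    HasSum ((loopFrom t t).stopProb p b)
      (t.eval p (hit b) / (t.eval p (hit true) + t.eval p (hit false))) := by
  have ht : restart t t = t := by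
    match t with
    | .leaf none => rfl
    | .leaf (some b) => rfl
    | .node U c => rfl
  have e := tsum_loopFrom_restart (root := t) (p := p) (b := b) t
  have e' : t.eval p (fun o => 1 - (hit true o + hit false o)) =
      1 - (t.eval p (hit true) + t.eval p (hit false)) := by
    have := t.eval_add p (fun o => 1 - (hit true o + hit false o))
      (fun o => hit true o + hit false o)
    simp only [sub_add_cancel, Tree.eval_const, Tree.eval_add] at this
    linarith
  rw [ht, Tree.eval_add, Tree.eval_mul_right, e'] at e
  have hs := (summable_loopFrom (root := t) (p := p) (b := b) t).hasSum
  convert hs using 1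
  rw [div_eq_iff h]
  linarith

/-! ### Trees with constant bias -/

theorem Tree.eval_bool (p : unitInterval) (g : Bool → ℝ) (t : Tree Bool) :
    t.eval p g = t.eval p (fun b => if b then 1 else 0) * g true +
      (1 - t.eval p (fun b => if b then 1 else 0)) * g false := by
  have h : g = fun b => (if b then 1 else 0) * (g true - g false) + g false := by
    funext b; cases b <;> simp
  conv_lhs => rw [h]
  rw [Tree.eval_add, Tree.eval_mul_right, Tree.eval_const]
  ring

/-- The gate with real first row `(c, d)`. -/
def realGate (c d : ℝ) (h : c ^ 2 + d ^ 2 = 1) : Gate :=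
  rowGate c d (by simpa using h)

theorem tossProb_realGate_zero (c d : ℝ) (h : c ^ 2 + d ^ 2 = 1) (p : unitInterval) :
    tossProb (realGate c d h) p 0 = (c * ampZero p + d * ampOne p) ^ 2 := by
  rw [realGate, tossProb_rowGate_zero, ← Complex.ofReal_mul, ← Complex.ofReal_mul,
    ← Complex.ofReal_add, Complex.norm_real, Real.norm_eq_abs, sq_abs]

theorem tossProb_realGate_one (c d : ℝ) (h : c ^ 2 + d ^ 2 = 1) (p : unitInterval) :
    tossProb (realGate c d h) p 1 = (d * ampZero p - c * ampOne p) ^ 2 := by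
  have h1 := tossProb_add (realGate c d h) p
  rw [tossProb_realGate_zero] at h1
  linear_combination h1 - ampZero_sq_add_ampOne_sq p -
    (ampZero p ^ 2 + ampOne p ^ 2) * h

theorem invSqrtTwo_sq : (√2)⁻¹ ^ 2 = (1 / 2 : ℝ) := by
  rw [inv_pow, Real.sq_sqrt (by norm_num)]; norm_num

/-- A gate for which both outcomes have probability `1 / 2` for all coins `|p⟩`. -/
def fairGate : Gate :=
  rowGate ((√2)⁻¹ : ℝ) (((√2)⁻¹ : ℝ) * Complex.I) (by
    rw [norm_mul, Complex.norm_I, mul_one, Complex.norm_real, Real.norm_eq_abs, sq_abs,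
      invSqrtTwo_sq]
    norm_num)

/-- The coin has real amplitudes `s`, `t`, so `|s + i t|² = s² + t² = 1` whatever `p` is. -/
theorem tossProb_fairGate_zero (p : unitInterval) : tossProb fairGate p 0 = 1 / 2 := by
  rw [fairGate, tossProb_rowGate_zero]
  have : (((√2)⁻¹ : ℝ) : ℂ) * ampZero p + ((√2)⁻¹ : ℝ) * Complex.I * ampOne p =
      ((√2)⁻¹ : ℝ) * ((ampZero p : ℂ) + ampOne p * Complex.I) := by ring
  rw [this, norm_mul, mul_pow, ← Complex.normSq_eq_norm_sq (_ + _), Complex.normSq_add_mul_I,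
    ampZero_sq_add_ampOne_sq, Complex.norm_real, Real.norm_eq_abs, sq_abs, invSqrtTwo_sq, mul_one]

theorem tossProb_fairGate_one (p : unitInterval) : tossProb fairGate p 1 = 1 / 2 := by
  have := tossProb_add fairGate p
  rw [tossProb_fairGate_zero] at this
  linarith

/-- Continue with `t` or `u`, each with probability `1 / 2`. -/
def Tree.fair {α : Type} (t u : Tree α) : Tree α := .node fairGate ![t, u]

theorem Tree.eval_fair {α : Type} (p : unitInterval) (g : α → ℝ) (t u : Tree α) :
    (Tree.fair t u).eval p g = (t.eval p g + u.eval p g) / 2 := by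
  simp only [Tree.fair, Tree.eval, tossProb_fairGate_zero, tossProb_fairGate_one,
    Matrix.cons_val_zero, Matrix.cons_val_one]
  ring

/-- Measure one coin in a real basis, then a second one in a basis depending on the outcome. -/
def correlationTree (a b c d c' d' : ℝ) (h : a ^ 2 + b ^ 2 = 1) (h₀ : c ^ 2 + d ^ 2 = 1)
    (h₁ : c' ^ 2 + d' ^ 2 = 1) : Tree Bool :=
  .node (realGate a b h) ![.node (realGate c d h₀) ![.leaf true, .leaf false],
    .node (realGate c' d' h₁) ![.leaf true, .leaf false]]

theorem eval_correlationTree (a b c d c' d' : ℝ) (h : a ^ 2 + b ^ 2 = 1)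
    (h₀ : c ^ 2 + d ^ 2 = 1) (h₁ : c' ^ 2 + d' ^ 2 = 1) (p : unitInterval) :
    (correlationTree a b c d c' d' h h₀ h₁).eval p (fun b => if b then 1 else 0) =
      (a * ampZero p + b * ampOne p) ^ 2 * (c * ampZero p + d * ampOne p) ^ 2 +
      (b * ampZero p - a * ampOne p) ^ 2 * (c' * ampZero p + d' * ampOne p) ^ 2 := by
  simp [correlationTree, Tree.eval, tossProb_realGate_zero, tossProb_realGate_one]

/-- Write the coin as `(cos θ, sin θ)` and `(c, d) = (cos γ, sin γ)`. The first correlation tree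
gives `(1 + cos 2θ cos (2θ - 2γ)) / 2`; the second, with both bases turned by `π / 4`, has sines in
place of cosines. Their average `1 / 2 + cos (2γ) / 4` is free of `θ`. -/
theorem exists_tree_bias_of_mem_Icc {r : ℝ} (h₁ : 1 / 4 ≤ r) (h₂ : r ≤ 3 / 4) :
    ∃ t : Tree Bool, ∀ p, t.eval p (fun b => if b then 1 else 0) = r := by
  -- The solution of `c² + d² = 1` and `1 / 2 + (c² - d²) / 4 = r`; both values are nonnegative
  -- exactly for `r` in `[1 / 4, 3 / 4]`.
  obtain ⟨c, hc⟩ : ∃ c : ℝ, c ^ 2 = 2 * r - 1 / 2 := ⟨_, Real.sq_sqrt (by linarith)⟩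
  obtain ⟨d, hd⟩ : ∃ d : ℝ, d ^ 2 = 3 / 2 - 2 * r := ⟨_, Real.sq_sqrt (by linarith)⟩
  obtain ⟨e, he⟩ : ∃ e : ℝ, e ^ 2 = 1 / 2 := ⟨_, invSqrtTwo_sq⟩
  have hcd : c ^ 2 + d ^ 2 = 1 := by linarith
  refine ⟨.fair (correlationTree 1 0 c d d (-c) (by norm_num) hcd (by linarith))
    (correlationTree e e (e * (c - d)) (e * (c + d)) (e * (c + d)) (e * (d - c))
      (by linarith) (by linear_combination (2 * c ^ 2 + 2 * d ^ 2) * he + hcd)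
      (by linear_combination (2 * c ^ 2 + 2 * d ^ 2) * he + hcd)), fun p => ?_⟩
  rw [Tree.eval_fair, eval_correlationTree, eval_correlationTree]
  generalize hs : ampZero p = s
  generalize ht : ampOne p = t
  -- The average is a quartic form in `s`, `t`, namely a multiple of this one.
  have hst : (s ^ 2 + t ^ 2) ^ 2 = 1 := by
    rw [← hs, ← ht, ampZero_sq_add_ampOne_sq, one_pow]
  have he4 : e ^ 4 = 1 / 4 := by rw [show e ^ 4 = (e ^ 2) ^ 2 by ring, he]; norm_num
  have key : (e * s + e * t) ^ 2 * (e * (c - d) * s + e * (c + d) * t) ^ 2 +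
      (e * s - e * t) ^ 2 * (e * (c + d) * s + e * (d - c) * t) ^ 2 =
      e ^ 4 * ((s + t) ^ 2 * ((c - d) * s + (c + d) * t) ^ 2 +
        (s - t) ^ 2 * ((c + d) * s + (d - c) * t) ^ 2) := by ring
  rw [key, he4]
  linear_combination (3 / 4 * c ^ 2 + 1 / 4 * d ^ 2) * hst + 3 / 4 * hc + 1 / 4 * hd

/-- Fair coins halve a bias, so `r` is doubled until it reaches `1 / 4`. -/
theorem exists_tree_bias {r : ℝ} (h₁ : 0 < r) (h₂ : r ≤ 1 / 2) :
    ∃ t : Tree Bool, ∀ p, t.eval p (fun b => if b then 1 else 0) = r := by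
  obtain ⟨n, hn⟩ := exists_pow_lt_of_lt_one h₁ (show (1 / 2 : ℝ) < 1 by norm_num)
  induction n generalizing r with
  | zero => norm_num at hn; linarith
  | succ n ih =>
    rcases le_total (1 / 4) r with h | h
    · exact exists_tree_bias_of_mem_Icc h (by linarith)
    · obtain ⟨t, ht⟩ := ih (r := 2 * r) (by linarith) (by linarith) (by rw [pow_succ] at hn; linarith)
      refine ⟨.fair t (.leaf false), fun p => ?_⟩
      rw [Tree.eval_fair, ht]
      simp [Tree.eval]

/-! ### Weights proportional to outcome probabilities of a tree -/

/-- Some tree has, for each `b`, the result `some b` with probability proportional to `N b`. -/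
def Achievable (N : Bool → unitInterval → ℝ) : Prop :=
  ∃ κ : ℝ, 0 < κ ∧ ∃ t : Tree (Option Bool), ∀ p b, t.eval p (hit b) = κ * N b p

theorem achievable_zero : Achievable fun _ _ => 0 :=
  ⟨1, one_pos, .leaf none, fun p b => by simp [Tree.eval, hit]⟩

theorem exists_tree_scale (t : Tree (Option Bool)) {r : ℝ} (h₁ : 0 < r) (h₂ : r ≤ 1 / 2) :
    ∃ u : Tree (Option Bool), ∀ p b, u.eval p (hit b) = r * t.eval p (hit b) := by
  obtain ⟨v, hv⟩ := exists_tree_bias h₁ h₂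
  refine ⟨v.bind fun b => if b then t else .leaf none, fun p b => ?_⟩
  rw [Tree.eval_bind, Tree.eval_bool, hv]
  simp [Tree.eval, hit]

theorem Achievable.add {N M : Bool → unitInterval → ℝ} (hN : Achievable N) (hM : Achievable M) :
    Achievable fun b p => N b p + M b p := by
  obtain ⟨κ, hκ, t, ht⟩ := hN
  obtain ⟨μ, hμ, u, hu⟩ := hM
  have hm : 0 < min κ μ := lt_min hκ hμ
  -- Both trees are brought to the common scale `min κ μ / 2`, which keeps the two ratios at most `1
  -- / 2`; the fair choice halves it again.
  obtain ⟨t', ht'⟩ := exists_tree_scale t (r := min κ μ / (2 * κ)) (by positivity) (by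
    rw [div_le_iff₀ (by positivity)]; linarith [min_le_left κ μ])
  obtain ⟨u', hu'⟩ := exists_tree_scale u (r := min κ μ / (2 * μ)) (by positivity) (by
    rw [div_le_iff₀ (by positivity)]; linarith [min_le_right κ μ])
  refine ⟨min κ μ / 4, by positivity, .fair t' u', fun p b => ?_⟩
  rw [Tree.eval_fair, ht', hu', ht, hu]
  field_simp
  ring

theorem Achievable.div_mem_QC {N : Bool → unitInterval → ℝ} (hN : Achievable N)
    (h : ∀ p, 0 < N true p + N false p) {f : unitInterval → unitInterval}
    (hf : ∀ p, (f p : ℝ) = N true p / (N true p + N false p)) : f ∈ QC := by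
  obtain ⟨κ, hκ, t, ht⟩ := hN
  have h0 : ∀ p, t.eval p (hit true) + t.eval p (hit false) ≠ 0 := fun p => by
    rw [ht, ht, ← mul_add]
    exact (mul_pos hκ (h p)).ne'
  refine ⟨loopFrom t t, fun p => ⟨?_, ?_⟩⟩
  · convert hasSum_loop t p true (h0 p) using 1
    rw [hf, ht, ht, ← mul_add, mul_div_mul_left _ _ hκ.ne']
  · convert hasSum_loop t p false (h0 p) using 1
    rw [hf, ht, ht, ← mul_add, mul_div_mul_left _ _ hκ.ne', one_sub_div (h p).ne', add_sub_cancel_left]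

/-! ### Products of linear forms in the amplitudes -/

/-- Products of linear forms in `√p` and `√(1 - p)` with complex coefficients. -/
inductive Factored : (unitInterval → ℂ) → Prop
  | const (c : ℂ) : Factored fun _ => c
  | mul (α β : ℂ) {g : unitInterval → ℂ} (hg : Factored g) :
      Factored fun p => (α * ampZero p + β * ampOne p) * g p

/-- Each linear factor is one toss with the normalised coefficients as first row of the gate:
outcome `0` continues, outcome `1` fails. -/
theorem Factored.achievable {g : unitInterval → ℂ} (hg : Factored g) (d : Bool) :
    Achievable fun b p => hit b (some d) * ‖g p‖ ^ 2 := by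
  induction hg with
  | const c =>
    rcases eq_or_ne c 0 with rfl | hc
    · simpa using achievable_zero
    · refine ⟨(‖c‖ ^ 2)⁻¹, by positivity, .leaf (some d), fun p b => ?_⟩
      have : ‖c‖ ≠ 0 := by simpa using hc
      rw [Tree.eval]
      field_simp
  | @mul α β g hg ih =>
    obtain ⟨κ, hκ, t, ht⟩ := ih
    by_cases h : ‖α‖ ^ 2 + ‖β‖ ^ 2 = 0
    · have hα : α = 0 := by
        have : ‖α‖ ^ 2 = 0 := by nlinarith [sq_nonneg ‖α‖, sq_nonneg ‖β‖]
        simpa using this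
      have hβ : β = 0 := by
        have : ‖β‖ ^ 2 = 0 := by nlinarith [sq_nonneg ‖α‖, sq_nonneg ‖β‖]
        simpa using this
      simpa [hα, hβ] using achievable_zero
    · have hpos : 0 < ‖α‖ ^ 2 + ‖β‖ ^ 2 := lt_of_le_of_ne (by positivity) (Ne.symm h)
      obtain ⟨e, he⟩ : ∃ e : ℝ, e ^ 2 = (‖α‖ ^ 2 + ‖β‖ ^ 2)⁻¹ :=
        ⟨_, Real.sq_sqrt (by positivity)⟩
      have hU : ‖(e : ℂ) * α‖ ^ 2 + ‖(e : ℂ) * β‖ ^ 2 = 1 := by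
        rw [norm_mul, norm_mul, Complex.norm_real, Real.norm_eq_abs, mul_pow, mul_pow, sq_abs,
          ← mul_add, he, inv_mul_cancel₀ h]
      refine ⟨e ^ 2 * κ, by rw [he]; positivity, .node (rowGate _ _ hU) ![t, .leaf none],
        fun p b => ?_⟩
      have h0 : (Tree.leaf none).eval p (hit b) = 0 := by simp [Tree.eval, hit]
      have h1 : (e : ℂ) * α * ampZero p + e * β * ampOne p =
        e * (α * ampZero p + β * ampOne p) := by ring
      simp only [Tree.eval, Matrix.cons_val_zero, Matrix.cons_val_one, h0, ht,
        tossProb_rowGate_zero, h1, norm_mul, Complex.norm_real, Real.norm_eq_abs, mul_pow, sq_abs]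
      ring

/-! ### Zeros of linear forms and lower bounds near them -/

theorem sq_sub_le_of_eq_zero {α β : ℂ} {z : unitInterval}
    (h : α * ampZero z + β * ampOne z = 0) (p : unitInterval) :
    ‖α * ampOne z - β * ampZero z‖ ^ 2 * ((p : ℝ) - z) ^ 2 ≤
      ‖α * ampZero p + β * ampOne p‖ ^ 2 := by
  have hz := ampZero_sq_add_ampOne_sq z
  have hp := ampZero_sq_add_ampOne_sq p
  -- A linear form vanishing at `z` is a multiple of the determinant of the amplitude vectors of `p`
  -- and `z`, the sine of the angle between them.
  have e : α * ampZero p + β * ampOne p = (α * ampOne z - β * ampZero z) *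
      ((ampZero p * ampOne z - ampOne p * ampZero z : ℝ) : ℂ) := by
    have hz' : (ampZero z : ℂ) ^ 2 + (ampOne z : ℂ) ^ 2 = 1 := by exact_mod_cast hz
    push_cast
    linear_combination (ampZero p * ampZero z + ampOne p * ampOne z : ℂ) * h -
      (α * ampZero p + β * ampOne p) * hz'
  rw [e, norm_mul, mul_pow, Complex.norm_real, Real.norm_eq_abs, sq_abs]
  refine mul_le_mul_of_nonneg_left ?_ (sq_nonneg _)
  -- This is `sin² x - sin² y = sin (x - y) sin (x + y)`; the second factor is at most `1` in
  -- modulus.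
  have e' : (p : ℝ) - z = (ampZero p * ampOne z - ampOne p * ampZero z) *
      (ampZero p * ampOne z + ampOne p * ampZero z) := by
    rw [← ampZero_sq z, ← ampZero_sq p]
    linear_combination ampZero z ^ 2 * hp - ampZero p ^ 2 * hz
  rw [e', mul_pow]
  refine mul_le_of_le_one_right (sq_nonneg _) ?_
  have : (ampZero p * ampOne z + ampOne p * ampZero z) ^ 2 +
      (ampZero p * ampZero z - ampOne p * ampOne z) ^ 2 = 1 := by
    linear_combination hp + (ampZero p ^ 2 + ampOne p ^ 2) * hz
  nlinarith [sq_nonneg (ampZero p * ampZero z - ampOne p * ampOne z)]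

/-- The two expressions are the coordinates of `(α, β)` in an orthonormal basis, so they cannot both
vanish. -/
theorem norm_pos_of_eq_zero {α β : ℂ} {z : unitInterval} (h0 : ¬(α = 0 ∧ β = 0))
    (h : α * ampZero z + β * ampOne z = 0) : 0 < ‖α * ampOne z - β * ampZero z‖ := by
  rw [norm_pos_iff]
  intro h'
  have hz : (ampZero z : ℂ) ^ 2 + (ampOne z : ℂ) ^ 2 = 1 := by
    exact_mod_cast ampZero_sq_add_ampOne_sq z
  refine h0 ⟨?_, ?_⟩
  · linear_combination ampZero z * h + ampOne z * h' - α * hz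
  · linear_combination ampOne z * h - ampZero z * h' - β * hz

theorem finite_zeros_linear {α β : ℂ} (h0 : ¬(α = 0 ∧ β = 0)) :
    {p : unitInterval | α * ampZero p + β * ampOne p = 0}.Finite := by
  refine Set.Subsingleton.finite fun p hp z hz => ?_
  have h := sq_sub_le_of_eq_zero hz p
  have hpos := norm_pos_of_eq_zero h0 hz
  rw [show α * ampZero p + β * ampOne p = 0 from hp, norm_zero, zero_pow two_ne_zero] at h
  have : ((p : ℝ) - z) ^ 2 ≤ 0 := nonpos_of_mul_nonpos_right h (by positivity)
  have h2 : (p : ℝ) - z = 0 := by simpa using le_antisymm this (sq_nonneg _)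
  exact Subtype.ext (sub_eq_zero.1 h2)

/-- Near `z`, the function `g` is bounded below by a positive multiple of an even power of the
distance to `z`. -/
def PolyBoundedBelow (g : unitInterval → ℝ) (z : unitInterval) : Prop :=
  ∃ c δ : ℝ, 0 < c ∧ 0 < δ ∧ ∃ k : ℕ, ∀ p : unitInterval,
    (p : ℝ) ∈ Set.Icc ((z : ℝ) - δ) (z + δ) → c * ((p : ℝ) - z) ^ (2 * k) ≤ g p

theorem PolyBoundedBelow.mul {g h : unitInterval → ℝ} {z : unitInterval}
    (hg : PolyBoundedBelow g z) (hh : PolyBoundedBelow h z) (hg0 : ∀ p, 0 ≤ g p) :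
    PolyBoundedBelow (fun p => g p * h p) z := by
  obtain ⟨c, δ, hc, hδ, k, H⟩ := hg
  obtain ⟨c', δ', hc', hδ', k', H'⟩ := hh
  refine ⟨c * c', min δ δ', mul_pos hc hc', lt_min hδ hδ', k + k', fun p hp => ?_⟩
  have h1 := H p ⟨by linarith [hp.1, min_le_left δ δ'], by linarith [hp.2, min_le_left δ δ']⟩
  have h2 := H' p ⟨by linarith [hp.1, min_le_right δ δ'], by linarith [hp.2, min_le_right δ δ']⟩
  calc c * c' * ((p : ℝ) - z) ^ (2 * (k + k'))
      = (c * ((p : ℝ) - z) ^ (2 * k)) * (c' * ((p : ℝ) - z) ^ (2 * k')) := by ring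
    _ ≤ g p * h p := mul_le_mul h1 h2
        (mul_nonneg hc'.le ((even_two_mul k').pow_nonneg _)) (hg0 p)

theorem polyBoundedBelow_of_pos {g : unitInterval → ℝ} {z : unitInterval} (hg : Continuous g)
    (h : 0 < g z) : PolyBoundedBelow g z := by
  have hev : ∀ᶠ p in 𝓝 z, g z / 2 < g p := hg.continuousAt.eventually_const_lt (by linarith)
  obtain ⟨ε, hε, H⟩ := Metric.eventually_nhds_iff.1 hev
  refine ⟨g z / 2, ε / 2, by linarith, by linarith, 0, fun p hp => ?_⟩
  have : dist p z < ε := by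
    rw [Subtype.dist_eq, Real.dist_eq, abs_lt]
    constructor <;> linarith [hp.1, hp.2]
  simpa using (H this).le

theorem polyBoundedBelow_linear {α β : ℂ} (h0 : ¬(α = 0 ∧ β = 0)) (z : unitInterval) :
    PolyBoundedBelow (fun p => ‖α * ampZero p + β * ampOne p‖ ^ 2) z := by
  by_cases h : α * ampZero z + β * ampOne z = 0
  · exact ⟨_, 1, pow_pos (norm_pos_of_eq_zero h0 h) 2, one_pos, 1, fun p _ => by
      simpa using sq_sub_le_of_eq_zero h p⟩
  · refine polyBoundedBelow_of_pos ?_ (by positivity)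
    have := continuous_ampZero
    have := continuous_ampOne
    fun_prop

theorem Factored.zero_or {g : unitInterval → ℂ} (hg : Factored g) :
    (∀ p, g p = 0) ∨
      ({p | g p = 0}.Finite ∧ ∀ z, PolyBoundedBelow (fun p => ‖g p‖ ^ 2) z) := by
  induction hg with
  | const c =>
    rcases eq_or_ne c 0 with rfl | hc
    · exact Or.inl fun _ => rfl
    · exact Or.inr ⟨by simp [hc], fun z => polyBoundedBelow_of_pos continuous_const (by positivity)⟩
  | @mul α β g hg ih =>
    rcases ih with ih | ⟨hfin, hbd⟩
    · exact Or.inl fun p => by simp [ih p]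
    · by_cases h0 : α = 0 ∧ β = 0
      · exact Or.inl fun p => by simp [h0.1, h0.2]
      · refine Or.inr ⟨((finite_zeros_linear h0).union hfin).subset fun p hp => ?_, fun z => ?_⟩
        · exact mul_eq_zero.1 hp
        · simp only [norm_mul, mul_pow]
          exact (polyBoundedBelow_linear h0 z).mul (hbd z) fun p => by positivity

theorem Factored.continuous {g : unitInterval → ℂ} (hg : Factored g) : Continuous g := by
  induction hg with
  | const c => exact continuous_const
  | mul α β hg ih =>
    have := continuous_ampZero
    have := continuous_ampOne
    fun_prop

/-! ### Homogeneous polynomials in the amplitudes -/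

open Polynomial in
/-- The homogenisation of `P` in degree `n`, evaluated at the amplitudes of `|p⟩`. -/
def homogEval (n : ℕ) (P : ℂ[X]) (p : unitInterval) : ℂ :=
  ∑ i ∈ Finset.range (n + 1), P.coeff i * (ampZero p : ℂ) ^ i * (ampOne p : ℂ) ^ (n - i)

open Polynomial in
theorem homogEval_X_mul (n : ℕ) (P : ℂ[X]) (p : unitInterval) :
    homogEval (n + 1) (X * P) p = ampZero p * homogEval n P p := by
  rw [homogEval, Finset.sum_range_succ', homogEval, Finset.mul_sum]
  simp only [coeff_X_mul, coeff_X_mul_zero, zero_mul, add_zero, Nat.add_sub_add_right]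
  exact Finset.sum_congr rfl fun i _ => by ring

-- A drop in the degree of `P` below the formal degree is a factor `√(1 - p)`, the root at infinity.
open Polynomial in
theorem homogEval_succ {n : ℕ} {P : ℂ[X]} (hP : P.natDegree ≤ n) (p : unitInterval) :
    homogEval (n + 1) P p = ampOne p * homogEval n P p := by
  rw [homogEval, Finset.sum_range_succ, coeff_eq_zero_of_natDegree_lt (by omega), homogEval,
    Finset.mul_sum]
  simp only [zero_mul, add_zero]
  refine Finset.sum_congr rfl fun i hi => ?_
  rw [Nat.succ_sub (Nat.lt_succ_iff.1 (Finset.mem_range.1 hi)), pow_succ]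
  ring

open Polynomial in
theorem homogEval_add (n : ℕ) (P Q : ℂ[X]) (p : unitInterval) :
    homogEval n (P + Q) p = homogEval n P p + homogEval n Q p := by
  simp only [homogEval, coeff_add, add_mul, Finset.sum_add_distrib]

open Polynomial in
theorem homogEval_C_mul (n : ℕ) (c : ℂ) (P : ℂ[X]) (p : unitInterval) :
    homogEval n (C c * P) p = c * homogEval n P p := by
  simp only [homogEval, coeff_C_mul, Finset.mul_sum, mul_assoc]

-- The fundamental theorem of algebra for binary forms: a linear factor comes from the root at
-- infinity if the degree drops, and from a finite root of `P` otherwise.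
open Polynomial in
theorem factored_homogEval (n : ℕ) (P : ℂ[X]) (hP : P.natDegree ≤ n) :
    Factored (homogEval n P) := by
  induction n generalizing P with
  | zero =>
    have : homogEval 0 P = fun _ => P.coeff 0 := by funext p; simp [homogEval]
    rw [this]
    exact .const _
  | succ n ih =>
    by_cases h : P.natDegree ≤ n
    · have e : homogEval (n + 1) P =
          fun p => ((0 : ℂ) * ampZero p + 1 * ampOne p) * homogEval n P p := by
        funext p; rw [homogEval_succ h]; ring
      rw [e]
      exact .mul 0 1 (ih P h)
    · obtain ⟨z, hz⟩ := IsAlgClosed.exists_root P fun h' => h <| by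
        rw [natDegree_eq_of_degree_eq_some h']; exact n.zero_le
      obtain ⟨Q, rfl⟩ := dvd_iff_isRoot.2 hz
      have hQ0 : Q ≠ 0 := by rintro rfl; simp at h
      have hQ : Q.natDegree ≤ n := by
        rw [natDegree_mul (X_sub_C_ne_zero z) hQ0, natDegree_X_sub_C] at hP
        omega
      have e : homogEval (n + 1) ((X - C z) * Q) =
          fun p => ((1 : ℂ) * ampZero p + (-z) * ampOne p) * homogEval n Q p := by
        funext p
        rw [show (X - C z) * Q = X * Q + C (-z) * Q by rw [C_neg]; ring, homogEval_add,
          homogEval_C_mul, homogEval_X_mul, homogEval_succ hQ]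
        ring
      rw [e]
      exact .mul 1 (-z) (ih Q hQ)

open Polynomial in
/-- Functions given by a homogeneous polynomial of degree `n` in the amplitudes. -/
def forms (n : ℕ) : Submodule ℂ (unitInterval → ℂ) where
  carrier := {g | ∃ P : ℂ[X], P.natDegree ≤ n ∧ g = homogEval n P}
  zero_mem' := ⟨0, by simp, by funext p; simp [homogEval]⟩
  add_mem' := by
    rintro _ _ ⟨P, hP, rfl⟩ ⟨Q, hQ, rfl⟩
    exact ⟨P + Q, natDegree_add_le_of_degree_le hP hQ, by funext p; simp [homogEval_add]⟩
  smul_mem' := by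
    rintro c _ ⟨P, hP, rfl⟩
    exact ⟨C c * P, (natDegree_C_mul_le c P).trans hP, by funext p; simp [homogEval_C_mul]⟩

theorem factored_of_mem_forms {n : ℕ} {g : unitInterval → ℂ} (hg : g ∈ forms n) : Factored g := by
  obtain ⟨P, hP, rfl⟩ := hg
  exact factored_homogEval n P hP

theorem one_mem_forms : (fun _ => 1) ∈ forms 0 :=
  ⟨1, by simp, by funext p; simp [homogEval]⟩

theorem mul_coinKet_mem_forms {n : ℕ} {g : unitInterval → ℂ} (hg : g ∈ forms n) (b : Fin 2) :
    (fun p => g p * coinKet p b) ∈ forms (n + 1) := by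
  obtain ⟨P, hP, rfl⟩ := hg
  fin_cases b
  · refine ⟨.X * P, Polynomial.natDegree_mul_le.trans ?_, ?_⟩
    · rw [Polynomial.natDegree_X]; omega
    · funext p; rw [homogEval_X_mul, mul_comm]; rfl
  · refine ⟨P, by omega, ?_⟩
    funext p; rw [homogEval_succ hP, mul_comm]; rfl

/-! ### Amplitudes of procedures -/

/-- The branches do not depend on `p`, so one list of functions of `p` serves for all coins. Only a
coin raises the degree `m`; the other steps are linear with constant coefficients. -/
theorem Procedure.exists_outputs_eq {n : ℕ} (P : Procedure n) (m : ℕ)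
    (ψ : unitInterval → QState n) (hψ : ∀ x, (fun p => ψ p x) ∈ forms m) :
    ∃ L : List (unitInterval → QState 1), (∀ p, P.outputs p (ψ p) = L.map fun φ => φ p) ∧
      ∀ φ ∈ L, ∀ x, Factored fun p => φ p x := by
  induction P generalizing m with
  | done => exact ⟨[ψ], fun p => rfl, by simpa using fun x => factored_of_mem_forms (hψ x)⟩
  | fail => exact ⟨[], fun p => rfl, by simp⟩
  | coin next ih =>
    exact ih (m + 1) (fun p => adjoin (ψ p) (coinKet p)) fun x => mul_coinKet_mem_forms (hψ _) _
  | const a next ih =>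
    refine ih m (fun p => adjoin (ψ p) (constKet a)) fun x => ?_
    convert (forms m).smul_mem (constKet a (x (Fin.last _))) (hψ (Fin.init x)) using 1
    funext p
    exact mul_comm _ _
  | unitary U next ih =>
    refine ih m (fun p => (U : Matrix _ _ ℂ).mulVec (ψ p)) fun x => ?_
    convert (forms m).sum_mem (t := Finset.univ) fun y _ =>
      (forms m).smul_mem ((U : Matrix _ _ ℂ) x y) (hψ y) using 1
    funext p
    simp [Matrix.mulVec, dotProduct]
  | measure i next ih =>
    obtain ⟨L₀, h₀, h₀'⟩ := ih 0 m (fun p => collapse i 0 (ψ p)) fun x => hψ _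
    obtain ⟨L₁, h₁, h₁'⟩ := ih 1 m (fun p => collapse i 1 (ψ p)) fun x => hψ _
    refine ⟨L₀ ++ L₁, fun p => ?_, fun φ hφ => ?_⟩
    · rw [Procedure.outputs, h₀, h₁, List.map_append]
    · exact (List.mem_append.1 hφ).elim (h₀' φ) (h₁' φ)

/-- The total weight of the functions in a list. -/
def weight (L : List (unitInterval → ℂ)) (p : unitInterval) : ℝ :=
  (L.map fun g => ‖g p‖ ^ 2).sum

theorem continuous_weight {L : List (unitInterval → ℂ)} (hL : ∀ g ∈ L, Factored g) :
    Continuous (weight L) := by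
  unfold weight
  exact continuous_list_sum L fun g hg => ((hL g hg).continuous.norm.pow 2)

theorem norm_sq_le_weight {L : List (unitInterval → ℂ)} {g : unitInterval → ℂ} (hg : g ∈ L)
    (p : unitInterval) : ‖g p‖ ^ 2 ≤ weight L p := by
  refine List.single_le_sum ?_ _ (List.mem_map_of_mem hg)
  simp only [List.mem_map]
  rintro _ ⟨g, -, rfl⟩
  positivity

/-- All summands are nonnegative, so a single one that is not identically zero gives both
properties. -/
theorem weight_zero_or {L : List (unitInterval → ℂ)} (hL : ∀ g ∈ L, Factored g) :
    (∀ p, weight L p = 0) ∨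
      ({p | weight L p = 0}.Finite ∧ ∀ z, PolyBoundedBelow (weight L) z) := by
  by_cases h : ∀ g ∈ L, ∀ p, g p = 0
  · refine Or.inl fun p => List.sum_eq_zero ?_
    simp only [List.mem_map]
    rintro _ ⟨g, hg, rfl⟩
    simp [h g hg p]
  · push Not at h
    obtain ⟨g, hg, q, hq⟩ := h
    rcases (hL g hg).zero_or with h' | ⟨hfin, hbd⟩
    · exact absurd (h' q) hq
    · refine Or.inr ⟨hfin.subset fun p hp => ?_, fun z => ?_⟩
      · have h1 := norm_sq_le_weight hg p
        rw [show weight L p = 0 from hp] at h1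
        simpa using le_antisymm h1 (sq_nonneg _)
      · obtain ⟨c, δ, hc, hδ, k, H⟩ := hbd z
        exact ⟨c, δ, hc, hδ, k, fun p hp => (H p hp).trans (norm_sq_le_weight hg p)⟩

theorem achievable_weight {L : List (unitInterval → ℂ)} (hL : ∀ g ∈ L, Factored g) (d : Bool) :
    Achievable fun b p => hit b (some d) * weight L p := by
  induction L with
  | nil => simpa [weight] using achievable_zero
  | cons g L ih =>
    have h := ((hL g List.mem_cons_self).achievable d).add
      (ih fun g hg => hL g (List.mem_cons_of_mem _ hg))
    simpa only [weight, List.map_cons, List.sum_cons, mul_add] using h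

/-- The lists hold the `|0⟩` and the `|1⟩` amplitudes of the successful runs. In each run the `|0⟩`
part carries the same share `|k₀|² = f` of the squared norm, so it does so in the sum. -/
theorem exists_weights_of_mem_QQ {f : unitInterval → unitInterval} (hf : f ∈ QQ) :
    ∃ L₀ L₁ : List (unitInterval → ℂ), (∀ g ∈ L₀, Factored g) ∧ (∀ g ∈ L₁, Factored g) ∧
      ∀ p, 0 < weight L₀ p + weight L₁ p ∧ weight L₀ p = f p * (weight L₀ p + weight L₁ p) := by
  obtain ⟨k₀, k₁, ⟨hk, P, hP⟩, hf⟩ := hf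
  obtain ⟨L, hL, hL'⟩ := P.exists_outputs_eq 0 (fun _ => emptyRegister) fun _ => one_mem_forms
  refine ⟨L.map fun φ p => φ p fun _ => 0, L.map fun φ p => φ p fun _ => 1, ?_, ?_, fun p => ?_⟩
  · simp only [List.mem_map]
    rintro _ ⟨φ, hφ, rfl⟩
    exact hL' φ hφ _
  · simp only [List.mem_map]
    rintro _ ⟨φ, hφ, rfl⟩
    exact hL' φ hφ _
  · obtain ⟨hpos, hout⟩ := hP p
    simp only [Procedure.successProb, hL p, List.map_map] at hpos hout
    simp only [weight, List.map_map]
    have hsum : ∀ φ : QState 1, ∑ x, ‖φ x‖ ^ 2 = ‖φ fun _ => 0‖ ^ 2 + ‖φ fun _ => 1‖ ^ 2 := by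
      intro φ
      rw [← (Equiv.funUnique (Fin 1) (Fin 2)).symm.sum_comp, Fin.sum_univ_two]
      rfl
    have e : ∀ L : List (unitInterval → QState 1),
        (L.map ((fun g : unitInterval → ℂ => ‖g p‖ ^ 2) ∘ fun φ p => φ p fun _ => 0)).sum +
        (L.map ((fun g : unitInterval → ℂ => ‖g p‖ ^ 2) ∘ fun φ p => φ p fun _ => 1)).sum =
        (L.map ((fun φ : QState 1 => ∑ x, ‖φ x‖ ^ 2) ∘ fun φ => φ p)).sum := by
      intro L
      rw [← List.sum_map_add]
      exact congrArg List.sum (List.map_congr_left fun φ _ => (hsum (φ p)).symm)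
    rw [e]
    refine ⟨hpos, ?_⟩
    rw [← List.sum_map_mul_left]
    refine congrArg List.sum (List.map_congr_left fun φ hφ => ?_)
    obtain ⟨c, hc⟩ := hout (φ p) (List.mem_map_of_mem hφ)
    simp only [Function.comp_apply, hsum, hc, Matrix.cons_val_zero, Matrix.cons_val_one, norm_mul,
      mul_pow, ← mul_add, hk, hf]
    ring

/-! ### The two assertions about `QQ` -/

theorem QQ_subset_QC : QQ ⊆ QC := by
  intro f hf
  obtain ⟨L₀, L₁, h₀, h₁, h⟩ := exists_weights_of_mem_QQ hf
  refine ((achievable_weight h₀ true).add (achievable_weight h₁ false)).div_mem_QC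
    (fun p => ?_) fun p => ?_
  · simpa [hit] using (h p).1
  · rw [eq_div_iff]
    · simpa [hit] using (h p).2.symm
    · simpa [hit] using (h p).1.ne'

theorem spb_of_mem_QQ {f : unitInterval → unitInterval} (hf : f ∈ QQ) (hf0 : f ≠ fun _ => 0)
    (hf1 : f ≠ fun _ => 1) : SPB f := by
  obtain ⟨L₀, L₁, h₀, h₁, h⟩ := exists_weights_of_mem_QQ hf
  set D := fun p => weight L₀ p + weight L₁ p
  have hD : Continuous D := (continuous_weight h₀).add (continuous_weight h₁)
  have hD0 : ∀ p, 0 < D p := fun p => (h p).1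
  have e₀ : ∀ p, weight L₀ p = f p * D p := fun p => (h p).2
  have e₁ : ∀ p, weight L₁ p = (1 - f p) * D p := fun p => by
    have : D p = weight L₀ p + weight L₁ p := rfl
    linarith [e₀ p]
  -- Since `f = A / D` and `1 - f = B / D`, lower bounds for the weights `A` and `B` pass to `f` and
  -- `1 - f` after division by the maximum of `D`.
  obtain ⟨q, hq⟩ : ∃ q, ∀ p, D p ≤ D q := by
    obtain ⟨q, -, hq⟩ := isCompact_univ.exists_isMaxOn Set.univ_nonempty hD.continuousOn
    exact ⟨q, fun p => hq (Set.mem_univ p)⟩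
  have bound : ∀ (w g : unitInterval → ℝ) z, (∀ p, 0 ≤ g p) → (∀ p, w p = g p * D p) →
      PolyBoundedBelow w z → PolyBoundedBelow g z := by
    rintro w g z hg hw ⟨c, δ, hc, hδ, k, H⟩
    refine ⟨c / D q, δ, div_pos hc (hD0 q), hδ, k, fun p hp => ?_⟩
    rw [div_mul_eq_mul_div, div_le_iff₀ (hD0 q)]
    exact (H p hp).trans ((hw p).trans_le (mul_le_mul_of_nonneg_left (hq p) (hg p)))
  have n₀ : ¬∀ p, weight L₀ p = 0 := fun h' => hf0 <| funext fun p => by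
    have := e₀ p
    rw [h' p, zero_eq_mul, or_iff_left (hD0 p).ne'] at this
    exact Subtype.ext this
  have n₁ : ¬∀ p, weight L₁ p = 0 := fun h' => hf1 <| funext fun p => by
    have := e₁ p
    rw [h' p, zero_eq_mul, or_iff_left (hD0 p).ne'] at this
    exact Subtype.ext (sub_eq_zero.1 this).symm
  obtain ⟨fin₀, bd₀⟩ := (weight_zero_or h₀).resolve_left n₀
  obtain ⟨fin₁, bd₁⟩ := (weight_zero_or h₁).resolve_left n₁
  refine ⟨?_, ?_, ?_, ?_, ?_⟩
  · have : (fun p => (f p : ℝ)) = fun p => weight L₀ p / D p :=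
      funext fun p => by rw [eq_div_iff (hD0 p).ne', e₀]
    rw [continuous_induced_rng, Function.comp_def, this]
    exact (continuous_weight h₀).div₀ hD fun p => (hD0 p).ne'
  · refine fin₀.subset fun p (hp : f p = 0) => ?_
    simp [e₀, hp]
  · refine fin₁.subset fun p (hp : f p = 1) => ?_
    simp [e₁, hp]
  · exact fun z _ => bound _ (fun p => f p) z (fun p => (f p).2.1) e₀ (bd₀ z)
  · intro w _
    obtain ⟨c, δ, hc, hδ, k, H⟩ :=
      bound _ (fun p => 1 - f p) w (fun p => by linarith [(f p).2.2]) e₁ (bd₁ w)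
    exact ⟨c, δ, hc, hδ, k, fun p hp => by linarith [H p hp]⟩

end BernoulliFactory

end

theorem mainTheorem4 :
    (∀ f ∈ BernoulliFactory.QQ, f ≠ (fun _ => 0) → f ≠ (fun _ => 1) → BernoulliFactory.SPB f) ∧
      BernoulliFactory.QQ ⊆ BernoulliFactory.QC :=
  ⟨fun _ hf h₀ h₁ => BernoulliFactory.spb_of_mem_QQ hf h₀ h₁, BernoulliFactory.QQ_subset_QC⟩
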